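/- Let $n\ge 2$ and let all operators be bounded operators on complex Hilbert spaces. For $k\ge 1$ let $\Gamma_k=\{(e_1(z),\dots,e_k(z)) : z=(z_1,\dots,z_k)\in\mathbb C^k,\ |z_j|\le 1\}$, where $e_j$ is the $j$-th elementary symmetric polynomial in $k$ variables (so $\Gamma_1=\overline{\mathbb D}$). A $\Gamma_k$-contraction is a commuting $k$-tuple $T=(T_1,\dots,T_k)$ of operators whose Taylor joint spectrum lies in $\Gamma_k$ and which satisfies $\|f(T)\|\le\sup_{\Gamma_k}|f|$ for every polynomial $f\in\mathbb C[x_1,\dots,x_k]$. For a contraction $T$ put $D_T=(I-T^*T)^{1/2}$ and $\mathcal D_T=\overline{\operatorname{Ran}}\,D_T$. Let $(S_1,\dots,S_{n-1},P)$ be a pure $\Gamma_n$-contraction on a Hilbert space $\mathcal H$, i.e. a $\Gamma_n$-contraction such that ${P^*}^k\to0$ strongly as $k\to\infty$. Let $(F_{1*},\dots,F_{(n-1)*})$ be the fundamental operator tuple of $(S_1^*,\dots,S_{n-1}^*,P^*)$, that is, the operators on $\mathcal D_{P^*}$ with $$S_i^*-S_{n-i}P^*=D_{P^*}F_{i*}D_{P^*},\qquad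 i=1,\dots,n-1,$$ and suppose that for every $z\in\overline{\mathbb D}$ $$\Big(\tfrac{n-1}{n}(F_{1*}^*+F_{(n-1)*}z),\ \tfrac{n-2}{n}(F_{2*}^*+F_{(n-2)*}z),\ \dots,\ \tfrac1n(F_{(n-1)*}^*+F_{1*}z)\Big)$$ is a $\Gamma_{n-1}$-contraction. Let $H^2(\mathbb D)$ be the Hardy space of the unit disc, $M_z$ multiplication by $z$ on it, let $$\Theta_P(z)=\big[-P+zD_{P^*}(I-zP^*)^{-1}D_P\big]\big|_{\mathcal D_P}:\mathcal D_P\to\mathcal D_{P^*},\qquad z\in\mathbb D,$$ be the characteristic function of $P$, and let $M_{\Theta_P}:H^2(\mathbb D)\otimes\mathcal D_P\to H^2(\mathbb D)\otimes\mathcal D_{P^*}$, $(M_{\Theta_P}f)(z)=\Theta_P(z)f(z)$, be the corresponding multiplication operator, where $H^2(\mathbb D)\otimes E$ is identified with the space of $E$-valued power series $\sum_k a_kz^k$ with $\sum_k\|a_k\|^2<\infty$. Put $$\mathbb H_P=\big(H^2(\mathbb D)\otimes\mathcal D_{P^*}\big)\ominus M_{\Theta_P}\big(H^2(\mathbb D)\otimes\mathcal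 D_P\big).$$ Then $(S_1,\dots,S_{n-1},P)$ is unitarily equivalent to the tuple $(R_1,\dots,R_{n-1},R)$ on $\mathbb H_P$ given by $$R_i=P_{\mathbb H_P}\big(I\otimes F_{i*}^*+M_z\otimes F_{(n-i)*}\big)\big|_{\mathbb H_P}\quad(i=1,\dots,n-1),\qquad R=P_{\mathbb H_P}(M_z\otimes I)\big|_{\mathbb H_P},$$ i.e. there is one unitary $U:\mathcal H\to\mathbb H_P$ with $US_i=R_iU$ for $i=1,\dots,n-1$ and $UP=RU$. -/

import Mathlib

open scoped InnerProductSpace TensorProduct Topology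

noncomputable section

namespace SymPolydisc

/-! ### The Taylor joint spectrum -/

section Taylor

variable {X : Type*} [NormedAddCommGroup X] [NormedSpace ℂ X]

/-- The Koszul differential `D_T = ∑ i, T i ⊗ E i` on `X ⊗ Λ`, where `Λ` is the exterior algebra on
the generators `e_1, …, e_k` and `E i ξ = e_i ξ` is the creation operator. -/
def koszulD {k : ℕ} (T : Fin k → (X →L[ℂ] X)) :
    (X ⊗[ℂ] ExteriorAlgebra ℂ (Fin k → ℂ)) →ₗ[ℂ] (X ⊗[ℂ] ExteriorAlgebra ℂ (Fin k → ℂ)) :=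
  ∑ i, TensorProduct.map (T i : X →ₗ[ℂ] X)
    (LinearMap.mulLeft ℂ (ExteriorAlgebra.ι ℂ (Pi.single i (1 : ℂ) : Fin k → ℂ)))

/-- A tuple is non-singular if its Koszul complex is exact: `Ran D_T = Ker D_T`. -/
def IsNonsingular {k : ℕ} (T : Fin k → (X →L[ℂ] X)) : Prop :=
  LinearMap.range (koszulD T) = LinearMap.ker (koszulD T)

/-- The Taylor joint spectrum of a (commuting) tuple of bounded operators. -/
def taylorSpectrum {k : ℕ} (T : Fin k → (X →L[ℂ] X)) : Set (Fin k → ℂ) :=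
  {l | ¬ IsNonsingular fun i => T i - l i • (1 : X →L[ℂ] X)}

end Taylor

/-! ### The symmetrized polydisc and the operators associated with it -/

/-- The closed symmetrized polydisc `Γ_k ⊆ ℂ^k`: the set of points `(s_1, …, s_k)` with `s_j` the
`j`-th elementary symmetric polynomial of some `z_1, …, z_k` in the closed unit disc. (Indices start
from `0` in the code; the last coordinate is the product `p = z_1 ⋯ z_k`.) -/
def Gam (k : ℕ) : Set (Fin k → ℂ) :=
  {s | ∃ z : Fin k → ℂ, (∀ j, ‖z j‖ ≤ 1) ∧
    ∀ i : Fin k, s i = ∑ t ∈ Finset.powersetCard ((i : ℕ) + 1) Finset.univ, ∏ j ∈ t, z j}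

section Contractions

variable {H : Type*} [NormedAddCommGroup H] [InnerProductSpace ℂ H]

/-- The operator `f(T_1, …, T_k)` for a polynomial `f` and a commuting tuple `T`. -/
def polyEval {k : ℕ} (f : MvPolynomial (Fin k) ℂ) (T : Fin k → (H →L[ℂ] H)) : H →L[ℂ] H :=
  ∑ m ∈ f.support, f.coeff m • (List.ofFn fun i => T i ^ m i).prod

/-- `T = (T_1, …, T_k)` is a `Γ_k`-contraction: a commuting tuple which has `Γ_k` as a spectral set,
that is, the Taylor joint spectrum of `T` lies in `Γ_k` and `‖f(T)‖ ≤ sup_{Γ_k} |f|` for all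
polynomials `f` in `k` variables. -/
structure IsGamContraction {k : ℕ} (T : Fin k → (H →L[ℂ] H)) : Prop where
  commute : ∀ i j, Commute (T i) (T j)
  spectrum_subset : taylorSpectrum T ⊆ Gam k
  norm_le : ∀ f : MvPolynomial (Fin k) ℂ,
    ‖polyEval f T‖ ≤ sSup ((fun s : Fin k → ℂ => ‖MvPolynomial.eval s f‖) '' Gam k)

variable [CompleteSpace H]

/-- `P` is a pure contraction: `P` is a contraction and `(P^*)^k → 0` strongly. -/
def IsPureContraction (P : H →L[ℂ] H) : Prop :=
  ‖P‖ ≤ 1 ∧ ∀ h : H, Filter.Tendsto (fun k : ℕ => (P.adjoint ^ k) h) Filter.atTop (𝓝 0)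

/-- The defect operator `D_P = (I - P^* P)^{1/2}`. -/
def defectOp (P : H →L[ℂ] H) : H →L[ℂ] H :=
  CFC.sqrt (1 - P.adjoint * P)

/-- The defect space `𝒟_P`, the closure of the range of `D_P`. -/
abbrev DefectSpace (P : H →L[ℂ] H) : Submodule ℂ H :=
  (LinearMap.range (defectOp P : H →ₗ[ℂ] H)).topologicalClosure

lemma defectOp_mem (P : H →L[ℂ] H) (h : H) : defectOp P h ∈ DefectSpace P :=
  Submodule.le_topologicalClosure _ ⟨h, rfl⟩

/-- `(F_1, …, F_{n-1})`, a tuple of operators on `𝒟_P`, is the fundamental operator tuple of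
`(S_1, …, S_{n-1}, P)`: `S_i - S_{n-i}^* P = D_P F_i D_P` for `i = 1, …, n - 1`. Here `m = n - 1`,
the entry `S_i` has index `i - 1` in `Fin m`, and `Fin.rev` is the reflection `i ↦ n - i`. -/
def IsFundamentalTuple {m : ℕ} (S : Fin m → (H →L[ℂ] H)) (P : H →L[ℂ] H)
    (F : Fin m → (DefectSpace P →L[ℂ] DefectSpace P)) : Prop :=
  ∀ (i : Fin m) (h : H),
    S i h - (S i.rev).adjoint (P h) = defectOp P (F i ⟨defectOp P h, defectOp_mem P h⟩ : H)

end Contractions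

/-! ### The vector-valued Hardy space on the disc -/

section Hardy

set_option linter.unusedSectionVars false

variable {E : Type*} [NormedAddCommGroup E] [InnerProductSpace ℂ E]
variable {F : Type*} [NormedAddCommGroup F] [InnerProductSpace ℂ F]

/-- The Hilbert space `H²(𝔻) ⊗ E`, i.e. the space of the `E`-valued power series
`f(z) = ∑ z^k a_k` with `∑ ‖a_k‖² < ∞`, given through the coefficient sequence `(a_k)`. The
elementary tensor `z^k ⊗ ξ` is the sequence with the single entry `ξ` in place `k`. -/
abbrev Hardy (E : Type*) [NormedAddCommGroup E] : Type _ := lp (fun _ : ℕ => E) 2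

/-- The value `f(z) = ∑ z^k a_k` at a point `z` of the open unit disc. -/
def Hardy.eval (f : Hardy E) (z : ℂ) : E := ∑' k : ℕ, z ^ k • f k

lemma Hardy.summable [CompleteSpace E] (f : Hardy E) {z : ℂ} (hz : ‖z‖ < 1) :
    Summable fun k : ℕ => z ^ k • f k := by
  refine Summable.of_norm_bounded
    ((summable_geometric_of_lt_one (norm_nonneg z) hz).mul_right ‖f‖) fun k => ?_
  rw [norm_smul, norm_pow]
  exact mul_le_mul_of_nonneg_left (lp.norm_apply_le_norm (by norm_num) f k) (by positivity)

/-- The coefficient sequence of `z f(z)`. -/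
def shiftFun (f : ℕ → E) : ℕ → E
  | 0 => 0
  | k + 1 => f k

lemma hasSum_shiftFun (f : Hardy E) :
    HasSum (fun k => ‖shiftFun (f : ℕ → E) k‖ ^ (2 : ENNReal).toReal)
      (‖f‖ ^ (2 : ENNReal).toReal) := by
  have h := lp.hasSum_norm (by norm_num) f
  rw [← hasSum_nat_add_iff' 1]
  simpa [shiftFun] using h

/-- The operator `M_z ⊗ I` of multiplication by the independent variable on `H²(𝔻) ⊗ E`. -/
def Mz (E : Type*) [NormedAddCommGroup E] [InnerProductSpace ℂ E] : Hardy E →L[ℂ] Hardy E :=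
  LinearMap.mkContinuous
    { toFun := fun f => ⟨shiftFun f, memℓp_gen (hasSum_shiftFun f).summable⟩
      map_add' := fun f g => by
        ext k
        change shiftFun (⇑(f + g)) k = shiftFun (⇑f) k + shiftFun (⇑g) k
        cases k <;> simp [shiftFun]
      map_smul' := fun c f => by
        ext k
        change shiftFun (⇑(c • f)) k = c • shiftFun (⇑f) k
        cases k <;> simp [shiftFun] }
    1 fun f => by
      refine le_of_eq ?_
      rw [one_mul]
      have h := (lp.hasSum_norm (p := 2) (by norm_num)
        (⟨shiftFun f, memℓp_gen (hasSum_shiftFun f).summable⟩ : Hardy E)).unique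
        (hasSum_shiftFun f)
      exact (Real.rpow_left_inj (norm_nonneg _) (norm_nonneg _) (by norm_num)).1 h

/-- The operator `I ⊗ A` on `H²(𝔻) ⊗ E`. -/
def idTensor (A : E →L[ℂ] E) : Hardy E →L[ℂ] Hardy E :=
  lp.mapCLM 2 (fun _ => A) (norm_nonneg A) fun _ => le_rfl

lemma eval_Mz [CompleteSpace E] (f : Hardy E) {z : ℂ} (hz : ‖z‖ < 1) :
    (Mz E f).eval z = z • f.eval z := by
  have h := (Mz E f).summable hz
  unfold Hardy.eval
  rw [h.tsum_eq_zero_add, ← (f.summable hz).tsum_const_smul z]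
  simp [Mz, shiftFun, pow_succ', mul_smul]

lemma eval_idTensor [CompleteSpace E] (A : E →L[ℂ] E) (f : Hardy E) {z : ℂ} (hz : ‖z‖ < 1) :
    (idTensor A f).eval z = A (f.eval z) := by
  unfold Hardy.eval
  rw [A.map_tsum (f.summable hz)]
  simp [idTensor]

/-- The range `M_Θ (H²(𝔻) ⊗ E)` of the multiplication operator `(M_Θ f)(z) = Θ(z) f(z)` of an
operator-valued function `Θ(z) : E → F` on the open unit disc, as a subspace of `H²(𝔻) ⊗ F`. -/
def multRange [CompleteSpace E] [CompleteSpace F] (Θ : ℂ → (E →L[ℂ] F)) :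
    Submodule ℂ (Hardy F) where
  carrier := {g | ∃ f : Hardy E, ∀ z : ℂ, ‖z‖ < 1 → g.eval z = Θ z (f.eval z)}
  zero_mem' := ⟨0, fun z _ => by simp [Hardy.eval]⟩
  add_mem' := by
    rintro g₁ g₂ ⟨f₁, h₁⟩ ⟨f₂, h₂⟩
    refine ⟨f₁ + f₂, fun z hz => ?_⟩
    have hf : (f₁ + f₂).eval z = f₁.eval z + f₂.eval z := by
      unfold Hardy.eval
      rw [← (f₁.summable hz).tsum_add (f₂.summable hz)]; simp
    have hg : (g₁ + g₂).eval z = g₁.eval z + g₂.eval z := by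
      unfold Hardy.eval
      rw [← (g₁.summable hz).tsum_add (g₂.summable hz)]; simp
    rw [hf, hg, map_add, h₁ z hz, h₂ z hz]
  smul_mem' := by
    rintro c g ⟨f, h⟩
    refine ⟨c • f, fun z hz => ?_⟩
    have hf : (c • f).eval z = c • f.eval z := by
      unfold Hardy.eval
      rw [← (f.summable hz).tsum_const_smul c]; simp [smul_comm c]
    have hg : (c • g).eval z = c • g.eval z := by
      unfold Hardy.eval
      rw [← (g.summable hz).tsum_const_smul c]; simp [smul_comm c]
    rw [hf, hg, map_smul, h z hz]

/-- The compression `P_K T |_K` of `T` to a subspace `K`. -/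
def compression (K : Submodule ℂ E) [K.HasOrthogonalProjection] (T : E →L[ℂ] E) : K →L[ℂ] K :=
  K.orthogonalProjectionOnto ∘L T ∘L K.subtypeL

end Hardy

/-! ### The characteristic function and the model space -/

section Model

variable {H : Type*} [NormedAddCommGroup H] [InnerProductSpace ℂ H] [CompleteSpace H]

lemma defectOp_nonneg (P : H →L[ℂ] H) : 0 ≤ defectOp P := CFC.sqrt_nonneg _

lemma defectOp_star (P : H →L[ℂ] H) : star (defectOp P) = defectOp P :=
  (IsSelfAdjoint.of_nonneg (defectOp_nonneg P)).star_eq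

lemma one_sub_nonneg_of_norm_le {P : H →L[ℂ] H} (hP : ‖P‖ ≤ 1) : 0 ≤ 1 - P.adjoint * P := by
  have h1 : 0 ≤ P.adjoint * P := by
    rw [← ContinuousLinearMap.star_eq_adjoint]; exact star_mul_self_nonneg P
  rw [sub_nonneg, ← CStarAlgebra.norm_le_one_iff_of_nonneg _ h1,
    ← ContinuousLinearMap.star_eq_adjoint, CStarRing.norm_star_mul_self]
  nlinarith [norm_nonneg P]

lemma defectOp_mul_self {P : H →L[ℂ] H} (hP : ‖P‖ ≤ 1) :
    defectOp P * defectOp P = 1 - star P * P :=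
  CFC.sqrt_mul_sqrt_self _ (one_sub_nonneg_of_norm_le hP)

lemma defectOp_adjoint_mul_self {P : H →L[ℂ] H} (hP : ‖P‖ ≤ 1) :
    defectOp P.adjoint * defectOp P.adjoint = 1 - P * star P := by
  have h : ‖P.adjoint‖ ≤ 1 := by rwa [LinearIsometryEquiv.norm_map]
  rw [defectOp_mul_self h, ContinuousLinearMap.star_eq_adjoint,
    ContinuousLinearMap.adjoint_adjoint, ContinuousLinearMap.star_eq_adjoint]

lemma intertwine_aux {A : Type*} [CStarAlgebra A] [PartialOrder A] [StarOrderedRing A]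
    {P D E : A} (hD : 0 ≤ D) (hE : 0 ≤ E) (hDD : D * D = 1 - star P * P)
    (hEE : E * E = 1 - P * star P) : P * D = E * P := by
  have hDs : star D = D := (IsSelfAdjoint.of_nonneg hD).star_eq
  have hEs : star E = E := (IsSelfAdjoint.of_nonneg hE).star_eq
  set Y := P * D - E * P with hY
  have hYs : star Y = D * star P - star P * E := by simp [hY, hDs, hEs]
  have h1 : E * Y = -(Y * D) := by
    have : E * Y + Y * D = P * (D * D) - (E * E) * P := by rw [hY]; noncomm_ring
    rw [hDD, hEE] at this
    have h0 : E * Y + Y * D = 0 := by rw [this]; noncomm_ring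
    exact eq_neg_of_add_eq_zero_left h0
  have h2 : star Y * E = -(D * star Y) := by
    have := congrArg star h1
    simpa [hDs, hEs] using this
  have hcomm : Commute (star Y * Y) D := by
    change star Y * Y * D = D * (star Y * Y)
    have a : star Y * Y * D = -(star Y * (E * Y)) := by rw [h1]; noncomm_ring
    have b : D * (star Y * Y) = -((star Y * E) * Y) := by rw [h2]; noncomm_ring
    rw [a, b, mul_assoc]
  have hpos : 0 ≤ star Y * Y * D :=
    hcomm.mul_nonneg (star_mul_self_nonneg Y) hD
  have hneg : star Y * Y * D ≤ 0 := by
    have a : star Y * Y * D = -(star Y * E * Y) := by rw [mul_assoc (star Y) E, h1]; noncomm_ring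
    rw [a, neg_nonpos]
    exact star_left_conjugate_nonneg hE Y
  have hz : star Y * Y * D = 0 := le_antisymm hneg hpos
  have hYD : Y * D = 0 := by
    rw [← CStarRing.star_mul_self_eq_zero_iff]
    have : star (Y * D) * (Y * D) = D * (star Y * Y * D) := by
      rw [star_mul, hDs]; noncomm_ring
    rw [this, hz, mul_zero]
  have hEY : E * Y = 0 := by rw [h1, hYD, neg_zero]
  have hYY : star Y * Y = D * (star P * Y) := by
    rw [hYs, sub_mul, mul_assoc (star P) E Y, hEY]; noncomm_ring
  have hq : star (star Y * Y) * (star Y * Y) = 0 := by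
    have : star (star Y * Y) = star Y * Y := by simp
    rw [this]
    nth_rewrite 2 [hYY]
    rw [← mul_assoc, hz, zero_mul]
  have hY0 : Y = 0 := by
    rw [CStarRing.star_mul_self_eq_zero_iff, CStarRing.star_mul_self_eq_zero_iff] at hq
    exact hq
  exact sub_eq_zero.1 hY0

/-- The relation `P D_P = D_{P^*} P`. -/
lemma mul_defectOp {P : H →L[ℂ] H} (hP : ‖P‖ ≤ 1) :
    P * defectOp P = defectOp P.adjoint * P :=
  intertwine_aux (defectOp_nonneg P) (defectOp_nonneg _) (defectOp_mul_self hP)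
    (defectOp_adjoint_mul_self hP)

lemma defectOp_eq_zero {P : H →L[ℂ] H} (hP : ¬ ‖P‖ ≤ 1) : defectOp P = 0 := by
  refine CFC.sqrt_of_not_nonneg fun h => hP ?_
  have h1 : 0 ≤ P.adjoint * P := by
    rw [← ContinuousLinearMap.star_eq_adjoint]; exact star_mul_self_nonneg P
  rw [sub_nonneg, ← CStarAlgebra.norm_le_one_iff_of_nonneg _ h1,
    ← ContinuousLinearMap.star_eq_adjoint, CStarRing.norm_star_mul_self] at h
  nlinarith [norm_nonneg P]

/-- `P` maps `𝒟_P` into `𝒟_{P^*}`. -/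
lemma map_mem_defectSpace (P : H →L[ℂ] H) {x : H} (hx : x ∈ DefectSpace P) :
    P x ∈ DefectSpace P.adjoint := by
  have key : ∀ y : H, P (defectOp P y) ∈ DefectSpace P.adjoint := by
    intro y
    by_cases hP : ‖P‖ ≤ 1
    · have : P (defectOp P y) = defectOp P.adjoint (P y) :=
        congrArg (fun T : H →L[ℂ] H => T y) (mul_defectOp hP)
      rw [this]
      exact defectOp_mem _ _
    · rw [defectOp_eq_zero hP]; simp
  have hcl : IsClosed {x : H | P x ∈ DefectSpace P.adjoint} :=
    (Submodule.isClosed_topologicalClosure _).preimage P.continuous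
  have hsub : (LinearMap.range (defectOp P : H →ₗ[ℂ] H) : Set H) ⊆
      {x : H | P x ∈ DefectSpace P.adjoint} := by
    rintro _ ⟨y, rfl⟩
    exact key y
  exact closure_minimal hsub hcl hx

/-- The Sz.-Nagy–Foias characteristic function
`Θ_P(z) = [-P + z D_{P^*} (I - z P^*)⁻¹ D_P]|_{𝒟_P} : 𝒟_P → 𝒟_{P^*}`. It is used only for `|z| < 1`,
where `I - z P^*` is invertible when `P` is a contraction. -/
def charFun (P : H →L[ℂ] H) (z : ℂ) : DefectSpace P →L[ℂ] DefectSpace P.adjoint :=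
  ((-P + z • (defectOp P.adjoint * Ring.inverse (1 - z • P.adjoint) * defectOp P)) ∘L
    (DefectSpace P).subtypeL).codRestrict (DefectSpace P.adjoint) fun x => by
      refine Submodule.add_mem _ (Submodule.neg_mem _ (map_mem_defectSpace P x.2))
        (Submodule.smul_mem _ z (defectOp_mem _ _))

lemma norm_sq_add_defectOp {T : H →L[ℂ] H} (hT : ‖T‖ ≤ 1) (x : H) :
    ‖T x‖ ^ 2 + ‖defectOp T x‖ ^ 2 = ‖x‖ ^ 2 := by
  have hs : (defectOp T).adjoint = defectOp T := defectOp_star T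
  have h : ⟪x, (defectOp T * defectOp T) x⟫_ℂ = ⟪x, (1 - star T * T) x⟫_ℂ := by
    rw [defectOp_mul_self hT]
  have h1 : ⟪x, (defectOp T * defectOp T) x⟫_ℂ = ⟪defectOp T x, defectOp T x⟫_ℂ := by
    conv_rhs => rw [← ContinuousLinearMap.adjoint_inner_right, hs]
    rfl
  have h2 : ⟪x, (1 - star T * T) x⟫_ℂ = ⟪x, x⟫_ℂ - ⟪T x, T x⟫_ℂ := by
    rw [← ContinuousLinearMap.adjoint_inner_right T]
    simp [ContinuousLinearMap.star_eq_adjoint]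
  rw [h1, h2, inner_self_eq_norm_sq_to_K, inner_self_eq_norm_sq_to_K,
    inner_self_eq_norm_sq_to_K] at h
  have h' : ‖defectOp T x‖ ^ 2 = ‖x‖ ^ 2 - ‖T x‖ ^ 2 := by exact_mod_cast h
  linarith

lemma energy {P : H →L[ℂ] H} (hP : ‖P‖ ≤ 1) (x f : H) :
    ‖P.adjoint x + defectOp P f‖ ^ 2 + ‖defectOp P.adjoint x - P f‖ ^ 2 = ‖x‖ ^ 2 + ‖f‖ ^ 2 := by
  have hP' : ‖P.adjoint‖ ≤ 1 := by rwa [LinearIsometryEquiv.norm_map]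
  have h1 := norm_sq_add_defectOp hP' x
  have h2 := norm_sq_add_defectOp hP f
  have hs : (defectOp P.adjoint).adjoint = defectOp P.adjoint := defectOp_star P.adjoint
  have hm : P (defectOp P f) = defectOp P.adjoint (P f) :=
    congrArg (fun T : H →L[ℂ] H => T f) (mul_defectOp hP)
  have hc : ⟪P.adjoint x, defectOp P f⟫_ℂ = ⟪defectOp P.adjoint x, P f⟫_ℂ := by
    rw [ContinuousLinearMap.adjoint_inner_left, hm, ← ContinuousLinearMap.adjoint_inner_left, hs]
  rw [norm_add_sq (𝕜 := ℂ), norm_sub_sq (𝕜 := ℂ), hc]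
  linarith

/-- The state sequence `x_0 = 0`, `x_{k+1} = P^* x_k + D_P f_k`. -/
def charState (P : H →L[ℂ] H) (f : ℕ → H) : ℕ → H
  | 0 => 0
  | k + 1 => P.adjoint (charState P f k) + defectOp P (f k)

/-- The multiplication operator `M_{Θ_P}` is defined on all of `H²(𝔻) ⊗ 𝒟_P`, and is a contraction:
for every `f` the function `z ↦ Θ_P(z) f(z)` lies in `H²(𝔻) ⊗ 𝒟_{P^*}`. -/
theorem exists_charFun_mul {P : H →L[ℂ] H} (hP : ‖P‖ ≤ 1) (f : Hardy (DefectSpace P)) :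
    ∃ g : Hardy (DefectSpace P.adjoint),
      (∀ z : ℂ, ‖z‖ < 1 → g.eval z = charFun P z (f.eval z)) ∧ ‖g‖ ≤ ‖f‖ := by
  set x := charState P (fun k => (f k : H)) with hx
  let g₀ : ℕ → DefectSpace P.adjoint := fun k =>
    ⟨defectOp P.adjoint (x k) - P (f k),
      Submodule.sub_mem _ (defectOp_mem _ _) (map_mem_defectSpace P (f k).2)⟩
  have hen : ∀ N : ℕ, ‖x N‖ ^ 2 + ∑ k ∈ Finset.range N, ‖g₀ k‖ ^ 2
      = ∑ k ∈ Finset.range N, ‖f k‖ ^ 2 := by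
    intro N
    induction N with
    | zero => simp [hx, charState]
    | succ N ih =>
      rw [Finset.sum_range_succ, Finset.sum_range_succ, ← ih]
      have h := energy hP (x N) (f N : H)
      have h1 : x (N + 1) = P.adjoint (x N) + defectOp P (f N) := rfl
      have h2 : ‖g₀ N‖ = ‖defectOp P.adjoint (x N) - P (f N)‖ := rfl
      have h3 : ‖f N‖ = ‖(f N : H)‖ := rfl
      rw [h1, h2, h3]
      linarith
  have hfs : ∀ N : ℕ, ∑ k ∈ Finset.range N, ‖f k‖ ^ 2 ≤ ‖f‖ ^ 2 := by
    intro N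
    have h := sum_le_hasSum (Finset.range N) (fun k _ => by positivity)
      (lp.hasSum_norm (p := 2) (by norm_num) f)
    simpa using h
  have hgs : ∀ s : Finset ℕ,
      ∑ k ∈ s, ‖g₀ k‖ ^ (2 : ENNReal).toReal ≤ ‖f‖ ^ (2 : ENNReal).toReal := by
    intro s
    obtain ⟨N, hN⟩ := s.exists_nat_subset_range
    have h1 := Finset.sum_le_sum_of_subset_of_nonneg (f := fun k => ‖g₀ k‖ ^ 2) hN
      fun k _ _ => by positivity
    have h2 := hen N
    have h3 := hfs N
    have h4 := sq_nonneg ‖x N‖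
    have h5 : ∑ k ∈ s, ‖g₀ k‖ ^ 2 ≤ ‖f‖ ^ 2 := by linarith
    simpa using h5
  let g : Hardy (DefectSpace P.adjoint) := ⟨g₀, memℓp_gen' hgs⟩
  refine ⟨g, fun z hz => ?_, lp.norm_le_of_forall_sum_le (by norm_num) (norm_nonneg f) hgs⟩
  have hxb : ∀ k, ‖x k‖ ≤ ‖f‖ := by
    intro k
    have h1 := hen k
    have h2 := hfs k
    have h3 : 0 ≤ ∑ k ∈ Finset.range k, ‖g₀ k‖ ^ 2 := Finset.sum_nonneg fun _ _ => by positivity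
    exact abs_le_of_sq_le_sq' (by linarith) (norm_nonneg f) |>.2
  have hX : Summable fun k : ℕ => z ^ k • x k := by
    refine Summable.of_norm_bounded
      ((summable_geometric_of_lt_one (norm_nonneg z) hz).mul_right ‖f‖) fun k => ?_
    rw [norm_smul, norm_pow]
    exact mul_le_mul_of_nonneg_left (hxb k) (by positivity)
  have hF : HasSum (fun k : ℕ => z ^ k • (f k : H)) (f.eval z : H) := by
    simpa [Hardy.eval] using (f.summable hz).hasSum.mapL (DefectSpace P).subtypeL
  have hG : HasSum (fun k : ℕ => z ^ k • (g₀ k : H)) (g.eval z : H) := by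
    exact (g.summable hz).hasSum.mapL (DefectSpace P.adjoint).subtypeL
  set X := ∑' k : ℕ, z ^ k • x k with hXd
  have hXe : X = z • (P.adjoint X + defectOp P (f.eval z : H)) := by
    have h1 := ((hX.hasSum.mapL P.adjoint).add (hF.mapL (defectOp P))).const_smul z
    have h2 : HasSum (fun k : ℕ => z ^ (k + 1) • x (k + 1)) X := by
      have := (hasSum_nat_add_iff' (f := fun k : ℕ => z ^ k • x k) 1).2 hX.hasSum
      simpa [hx, charState] using this
    refine h2.unique ?_
    convert h1 using 2 with k
    have h3 : x (k + 1) = P.adjoint (x k) + defectOp P (f k) := rfl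
    simp [h3, pow_succ', mul_smul]
  have hGe : (g.eval z : H) = defectOp P.adjoint X - P (f.eval z : H) := by
    refine hG.unique ?_
    convert (hX.hasSum.mapL (defectOp P.adjoint)).sub (hF.mapL P) using 2 with k
    simp [g₀, smul_sub]
  have hu : IsUnit (1 - z • P.adjoint) := by
    apply isUnit_one_sub_of_norm_lt_one
    have hP' : ‖P.adjoint‖ ≤ 1 := by rwa [LinearIsometryEquiv.norm_map]
    rw [norm_smul]
    nlinarith [norm_nonneg z, norm_nonneg P.adjoint]
  have hXi : X = z • Ring.inverse (1 - z • P.adjoint) (defectOp P (f.eval z : H)) := by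
    have h1 : (1 - z • P.adjoint) X = z • defectOp P (f.eval z : H) := by
      have : X - z • P.adjoint X = z • defectOp P (f.eval z : H) := by
        nth_rewrite 1 [hXe]
        rw [smul_add]; abel
      simpa using this
    have h2 : Ring.inverse (1 - z • P.adjoint) ((1 - z • P.adjoint) X) = X :=
      congrArg (fun T : H →L[ℂ] H => T X) (Ring.inverse_mul_cancel _ hu)
    rw [← h2, h1, map_smul]
  apply Subtype.ext
  rw [hGe, hXi]
  simp [charFun, sub_eq_add_neg, add_comm]

/-- The model space `ℍ_P = (H²(𝔻) ⊗ 𝒟_{P^*}) ⊖ M_{Θ_P} (H²(𝔻) ⊗ 𝒟_P)`. -/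
abbrev modelSpace (P : H →L[ℂ] H) : Submodule ℂ (Hardy (DefectSpace P.adjoint)) :=
  (multRange (charFun P))ᗮ

end Model

end SymPolydisc

end

noncomputable section

namespace SymPolydisc

/-! The model map `W h = (D_{P^*} P^{*k} h)_k`, the coefficient sequence of `D_{P^*} (I - z P^*)⁻¹
h`, is the required unitary. It is isometric because `‖D_{P^*} x‖² = ‖x‖² - ‖P^* x‖²` telescopes and
purity removes the remainder (`hasSum_modelSeq`).

Its range is exactly the model space. Multiplication by `Θ_P` sends `z^j ξ` to `z^{j+1} W(D_P ξ) -
z^j P ξ`, which is orthogonal to `Ran W`; contractivity of `M_{Θ_P}` extends this to all of its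
range (`modelIsometry_mem_modelSpace`). Conversely, orthogonality of `g` to these monomials forces
the vectors `W^* M_z^{*j} g` to form a `P^*`-orbit whose image under `D_{P^*}` is `g`
(`exists_modelIsometry_eq`).

The intertwining is checked on adjoints, where no projection is needed: `W P^* = M_z^* W` is
immediate, and `W S_i^* = (I ⊗ F_{i*} + M_z^* ⊗ F_{(n-i)*}^*) W` reduces, coefficient by
coefficient, to `D_{P^*} S_i^* = F_{i*} D_{P^*} + F_{(n-i)*}^* D_{P^*} P^*`
(`IsFundamentalTuple.defectOp_adjoint`). -/

lemma Hardy.ext {E : Type*} [NormedAddCommGroup E] {f g : Hardy E} (h : ∀ k, f k = g k) : f = g :=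
  lp.ext (funext h)

/-! ### Coefficients, values and adjoints on the Hardy space -/

section HardyLemmas

variable {E : Type*} [NormedAddCommGroup E] [InnerProductSpace ℂ E]

@[simp] lemma Mz_apply_zero (f : Hardy E) : Mz E f 0 = 0 := rfl

@[simp] lemma Mz_apply_succ (f : Hardy E) (k : ℕ) : Mz E f (k + 1) = f k := rfl

@[simp] lemma idTensor_apply (A : E →L[ℂ] E) (f : Hardy E) (k : ℕ) : idTensor A f k = A (f k) := rfl

lemma Hardy.inner_single_left (j : ℕ) (ξ : E) (f : Hardy E) :
    ⟪(lp.single 2 j ξ : Hardy E), f⟫_ℂ = ⟪ξ, f j⟫_ℂ := lp.inner_single_left j ξ f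

lemma Hardy.inner_eq_tsum (f g : Hardy E) : ⟪f, g⟫_ℂ = ∑' k, ⟪f k, g k⟫_ℂ := lp.inner_eq_tsum f g

lemma Hardy.summable_inner (f g : Hardy E) : Summable fun k => ⟪f k, g k⟫_ℂ :=
  lp.summable_inner f g

/-- Splits off the constant coefficient; this becomes the one-step recursion for `W^* M_z^{*j} g`.
-/
lemma Hardy.inner_eq_add_of_shift {f f' g g' : Hardy E} (hf : ∀ k, f' k = f (k + 1))
    (hg : ∀ k, g' k = g (k + 1)) : ⟪f, g⟫_ℂ = ⟪f 0, g 0⟫_ℂ + ⟪f', g'⟫_ℂ := by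
  rw [Hardy.inner_eq_tsum, Hardy.inner_eq_tsum f', (Hardy.summable_inner f g).tsum_eq_zero_add]
  simp only [hf, hg]

lemma Hardy.eval_sub [CompleteSpace E] (f g : Hardy E) {z : ℂ} (hz : ‖z‖ < 1) :
    (f - g).eval z = f.eval z - g.eval z := by
  unfold Hardy.eval
  rw [← (f.summable hz).tsum_sub (g.summable hz)]
  simp [smul_sub]

lemma Hardy.eval_single (j : ℕ) (ξ : E) (z : ℂ) :
    Hardy.eval (lp.single 2 j ξ : Hardy E) z = z ^ j • ξ := by
  unfold Hardy.eval
  rw [tsum_eq_single j fun k hk => by rw [lp.single_apply_ne _ _ _ hk, smul_zero]]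
  rw [lp.single_apply_self]

lemma Hardy.eval_Mz_pow [CompleteSpace E] (j : ℕ) (f : Hardy E) {z : ℂ} (hz : ‖z‖ < 1) :
    ((Mz E ^ j) f).eval z = z ^ j • f.eval z := by
  induction j with
  | zero => simp
  | succ j ih =>
    rw [pow_succ', mul_apply_eq_comp, eval_Mz _ hz, ih, pow_succ', mul_smul]

/-- A power series vanishing on the disc has zero coefficients. -/
lemma Hardy.eq_zero_of_eval_eq_zero [CompleteSpace E] {f : Hardy E}
    (hf : ∀ z : ℂ, ‖z‖ < 1 → f.eval z = 0) : f = 0 := by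
  let p : FormalMultilinearSeries ℂ ℂ E := fun n =>
    ContinuousMultilinearMap.mkPiRing ℂ (Fin n) (f n)
  have hcoeff : ∀ n, p.coeff n = f n := fun n => by simp [p, FormalMultilinearSeries.coeff]
  -- The coefficients of `f` form a power series of the zero function at `0`, so uniqueness makes
  -- them vanish.
  have hp : HasFPowerSeriesAt (fun _ : ℂ => (0 : E)) p 0 := by
    rw [hasFPowerSeriesAt_iff]
    filter_upwards [Metric.ball_mem_nhds (0 : ℂ) one_pos] with z hz
    have hz' : ‖z‖ < 1 := by simpa using hz
    have h := (f.summable hz').hasSum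
    rw [show ∑' k : ℕ, z ^ k • f k = 0 from hf z hz'] at h
    simpa only [hcoeff] using h
  ext n
  rw [← hcoeff, hp.eq_zero]
  rfl

lemma Hardy.eval_injective [CompleteSpace E] {f g : Hardy E}
    (h : ∀ z : ℂ, ‖z‖ < 1 → f.eval z = g.eval z) : f = g :=
  sub_eq_zero.1 <| Hardy.eq_zero_of_eval_eq_zero fun z hz => by
    rw [Hardy.eval_sub _ _ hz, h z hz, sub_self]

variable [CompleteSpace E]

/-- The adjoint of `M_z ⊗ I` is the backward shift. -/
@[simp] lemma adjoint_Mz_apply (f : Hardy E) (k : ℕ) : (Mz E).adjoint f k = f (k + 1) := by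
  refine ext_inner_left ℂ fun ξ => ?_
  have hs : Mz E (lp.single 2 k ξ) = lp.single 2 (k + 1) ξ := by
    ext n
    cases n with
    | zero => rw [Mz_apply_zero, lp.single_apply_ne _ _ _ (by simp)]
    | succ n => rw [Mz_apply_succ]; simp [Pi.single_apply]
  exact (Hardy.inner_single_left k ξ ((Mz E).adjoint f)).symm.trans <|
    (ContinuousLinearMap.adjoint_inner_right (Mz E) _ f).trans <|
    hs ▸ Hardy.inner_single_left (k + 1) ξ f

lemma adjoint_Mz_pow_apply (f : Hardy E) (j k : ℕ) :
    ((Mz E).adjoint ^ j) f k = f (k + j) := by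
  induction j generalizing k with
  | zero => simp
  | succ j ih =>
    rw [pow_succ', mul_apply_eq_comp, adjoint_Mz_apply, ih]
    rw [show k + 1 + j = k + (j + 1) by omega]

lemma inner_Mz_pow_left (j : ℕ) (f g : Hardy E) :
    ⟪(Mz E ^ j) f, g⟫_ℂ = ⟪f, ((Mz E).adjoint ^ j) g⟫_ℂ := by
  rw [← ContinuousLinearMap.adjoint_inner_right, ← ContinuousLinearMap.star_eq_adjoint,
    ← ContinuousLinearMap.star_eq_adjoint, star_pow]

lemma inner_Mz_pow_sub_single (j : ℕ) (f g : Hardy E) (ξ : E) :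
    ⟪(Mz E ^ (j + 1)) f - lp.single 2 j ξ, g⟫_ℂ
      = ⟪f, ((Mz E).adjoint ^ (j + 1)) g⟫_ℂ - ⟪ξ, g j⟫_ℂ := by
  rw [inner_sub_left, inner_Mz_pow_left, Hardy.inner_single_left]

lemma adjoint_idTensor (A : E →L[ℂ] E) : (idTensor A).adjoint = idTensor A.adjoint := by
  refine ContinuousLinearMap.ext fun f => Hardy.ext fun k => ext_inner_left ℂ fun ξ => ?_
  have hs : idTensor A (lp.single 2 k ξ) = lp.single 2 k (A ξ) := by
    ext n
    rw [idTensor_apply]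
    rcases eq_or_ne n k with rfl | h
    · simp only [lp.single_apply_self]
    · simp only [lp.single_apply_ne _ _ _ h, map_zero]
  rw [idTensor_apply, ContinuousLinearMap.adjoint_inner_right]
  exact (Hardy.inner_single_left k ξ ((idTensor A).adjoint f)).symm.trans <|
    (ContinuousLinearMap.adjoint_inner_right (idTensor A) _ f).trans <|
    hs ▸ Hardy.inner_single_left k (A ξ) f

end HardyLemmas

/-! ### From intertwined adjoints to compressions -/

section Compression

variable {H : Type*} [NormedAddCommGroup H] [InnerProductSpace ℂ H] [CompleteSpace H]

/-- If the unitary `U` of `H` onto `K` intertwines `A^*` with `T^*`, then `A` is unitarily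
equivalent to the compression of `T` to `K`. -/
lemma map_eq_compression {G : Type*} [NormedAddCommGroup G] [InnerProductSpace ℂ G]
    [CompleteSpace G] {K : Submodule ℂ G} [K.HasOrthogonalProjection] (U : H ≃ₗᵢ[ℂ] K)
    {A : H →L[ℂ] H} {T : G →L[ℂ] G} (hT : ∀ h, T.adjoint (U h) = (U (A.adjoint h) : G)) (h : H) :
    U (A h) = compression K T (U h) := by
  refine ext_inner_left ℂ fun g => ?_
  obtain ⟨g, rfl⟩ := U.surjective g
  have h1 : ⟪U g, compression K T (U h)⟫_ℂ = ⟪(U g : G), T (U h)⟫_ℂ :=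
    Submodule.inner_orthogonalProjectionOnto_eq_of_mem_left _ _
  rw [h1, LinearIsometryEquiv.inner_map_map, ← ContinuousLinearMap.adjoint_inner_left T, hT,
    ← Submodule.coe_inner, LinearIsometryEquiv.inner_map_map,
    ContinuousLinearMap.adjoint_inner_left]

variable {E : Type*} [NormedAddCommGroup E] [InnerProductSpace ℂ E] [CompleteSpace E]
  {K : Submodule ℂ (Hardy E)} [K.HasOrthogonalProjection] (U : H ≃ₗᵢ[ℂ] K) {A : H →L[ℂ] H}

lemma map_eq_compression_Mz
    (hA : ∀ h k, (U (A.adjoint h) : Hardy E) k = (U h : Hardy E) (k + 1)) (h : H) :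
    U (A h) = compression K (Mz E) (U h) :=
  map_eq_compression U (fun h => Hardy.ext fun k => by rw [adjoint_Mz_apply, hA]) h

/-- The adjoint of `I ⊗ B^* + M_z ⊗ C` is `I ⊗ B + M_z^* ⊗ C^*`, and `M_z^*` is the backward shift;
the hypothesis is its intertwining with `A^*`, read off at the `k`-th coefficient. -/
lemma map_eq_compression_idTensor_add_Mz (B C : E →L[ℂ] E)
    (hA : ∀ h k, (U (A.adjoint h) : Hardy E) k
      = B ((U h : Hardy E) k) + C.adjoint ((U h : Hardy E) (k + 1))) (h : H) :
    U (A h) = compression K (idTensor B.adjoint + Mz E ∘L idTensor C) (U h) := by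
  refine map_eq_compression U (fun h => Hardy.ext fun k => ?_) h
  rw [map_add, ContinuousLinearMap.adjoint_comp, adjoint_idTensor, adjoint_idTensor,
    ContinuousLinearMap.adjoint_adjoint, hA]
  exact congrArg (B _ + C.adjoint ·) (adjoint_Mz_apply _ k)

end Compression

/-! ### Defect identities and the model isometry -/

section ModelIsometry

variable {H : Type*} [NormedAddCommGroup H] [InnerProductSpace ℂ H] [CompleteSpace H]

lemma norm_adjoint_le_one {P : H →L[ℂ] H} (hP : ‖P‖ ≤ 1) : ‖P.adjoint‖ ≤ 1 := by
  rwa [LinearIsometryEquiv.norm_map]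

lemma inner_defectOp_left (P : H →L[ℂ] H) (x y : H) :
    ⟪defectOp P x, y⟫_ℂ = ⟪x, defectOp P y⟫_ℂ := by
  rw [← ContinuousLinearMap.adjoint_inner_right, show (defectOp P).adjoint = _ from defectOp_star P]

lemma map_defectOp {P : H →L[ℂ] H} (hP : ‖P‖ ≤ 1) (x : H) :
    P (defectOp P x) = defectOp P.adjoint (P x) :=
  congrArg (fun T : H →L[ℂ] H => T x) (mul_defectOp hP)

lemma adjoint_defectOp_adjoint {P : H →L[ℂ] H} (hP : ‖P‖ ≤ 1) (x : H) :
    P.adjoint (defectOp P.adjoint x) = defectOp P (P.adjoint x) := by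
  simpa using map_defectOp (norm_adjoint_le_one hP) x

lemma defectOp_defectOp {P : H →L[ℂ] H} (hP : ‖P‖ ≤ 1) (x : H) :
    defectOp P (defectOp P x) = x - P.adjoint (P x) :=
  congrArg (fun T : H →L[ℂ] H => T x) (defectOp_mul_self hP)

lemma defectOp_adjoint_defectOp_adjoint {P : H →L[ℂ] H} (hP : ‖P‖ ≤ 1) (x : H) :
    defectOp P.adjoint (defectOp P.adjoint x) = x - P (P.adjoint x) :=
  congrArg (fun T : H →L[ℂ] H => T x) (defectOp_adjoint_mul_self hP)

/-- Vectors of the defect space are determined by their inner products with the range of `D_P`. -/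
lemma eq_of_inner_defectOp {P : H →L[ℂ] H} {x y : H} (hx : x ∈ DefectSpace P)
    (hy : y ∈ DefectSpace P) (h : ∀ v, ⟪defectOp P v, x⟫_ℂ = ⟪defectOp P v, y⟫_ℂ) : x = y := by
  have hxy : x - y ∈ (DefectSpace P)ᗮ := by
    rw [Submodule.orthogonal_closure]
    rintro _ ⟨v, rfl⟩
    rw [inner_sub_right]
    exact sub_eq_zero.2 (h v)
  exact sub_eq_zero.1 <| inner_self_eq_zero.1 <| hxy _ (Submodule.sub_mem _ hx hy)

lemma inner_adjoint_isometry {K : Type*} [NormedAddCommGroup K] [InnerProductSpace ℂ K]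
    [CompleteSpace K] (W : H →ₗᵢ[ℂ] K) (v : H) (g : K) :
    ⟪v, W.toContinuousLinearMap.adjoint g⟫_ℂ = ⟪W v, g⟫_ℂ :=
  ContinuousLinearMap.adjoint_inner_right W.toContinuousLinearMap v g

/-- The coefficient sequence `(D_{P^*} P^{*k} h)_k` of the function
`z ↦ D_{P^*} (I - z P^*)⁻¹ h`. -/
def modelSeq (P : H →L[ℂ] H) (h : H) (k : ℕ) : DefectSpace P.adjoint :=
  ⟨defectOp P.adjoint ((P.adjoint ^ k) h), defectOp_mem _ _⟩

lemma hasSum_modelSeq {P : H →L[ℂ] H} (hP : IsPureContraction P) (h : H) :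
    HasSum (fun k => ‖modelSeq P h k‖ ^ 2) (‖h‖ ^ 2) := by
  rw [hasSum_iff_tendsto_nat_of_nonneg fun k => by positivity]
  -- The sum telescopes through `‖D_{P^*} x‖² = ‖x‖² - ‖P^* x‖²` at `x = P^{*k} h`; purity sends the
  -- last term to zero.
  have hsum : ∀ N, ∑ k ∈ Finset.range N, ‖modelSeq P h k‖ ^ 2
      = ‖h‖ ^ 2 - ‖(P.adjoint ^ N) h‖ ^ 2 := by
    intro N
    induction N with
    | zero => simp
    | succ N ih =>
      have h1 := norm_sq_add_defectOp (norm_adjoint_le_one hP.1) ((P.adjoint ^ N) h)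
      rw [Finset.sum_range_succ, ih, pow_succ' P.adjoint, mul_apply_eq_comp]
      change _ + ‖defectOp P.adjoint ((P.adjoint ^ N) h)‖ ^ 2 = _
      linarith
  simp only [hsum]
  simpa using ((hP.2 h).norm.pow 2).const_sub (‖h‖ ^ 2)

/-- The isometry `h ↦ D_{P^*} (I - z P^*)⁻¹ h` of `H` into `H²(𝔻) ⊗ 𝒟_{P^*}`. -/
def modelIsometry {P : H →L[ℂ] H} (hP : IsPureContraction P) :
    H →ₗᵢ[ℂ] Hardy (DefectSpace P.adjoint) where
  toFun h := ⟨modelSeq P h, memℓp_gen (by simpa using (hasSum_modelSeq hP h).summable)⟩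
  map_add' g h := Hardy.ext fun k => Subtype.ext <|
    (defectOp P.adjoint ∘L P.adjoint ^ k).map_add g h
  map_smul' c h := Hardy.ext fun k => Subtype.ext <|
    (defectOp P.adjoint ∘L P.adjoint ^ k).map_smul c h
  norm_map' h := by
    set f : Hardy (DefectSpace P.adjoint) :=
      ⟨modelSeq P h, memℓp_gen (by simpa using (hasSum_modelSeq hP h).summable)⟩ with hf
    have h1 := lp.hasSum_norm (p := 2) (by norm_num) f
    have h2 : ‖f‖ ^ 2 = ‖h‖ ^ 2 :=
      HasSum.unique (by simpa using h1) (hasSum_modelSeq hP h)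
    exact (sq_eq_sq₀ (norm_nonneg _) (norm_nonneg _)).1 h2

variable {P : H →L[ℂ] H} (hP : IsPureContraction P)

lemma coe_modelIsometry_apply (h : H) (k : ℕ) :
    (modelIsometry hP h k : H) = defectOp P.adjoint ((P.adjoint ^ k) h) := rfl

lemma adjoint_Mz_pow_modelIsometry (j : ℕ) (h : H) :
    ((Mz (DefectSpace P.adjoint)).adjoint ^ j) (modelIsometry hP h)
      = modelIsometry hP ((P.adjoint ^ j) h) := by
  refine Hardy.ext fun k => Subtype.ext ?_
  rw [adjoint_Mz_pow_apply, coe_modelIsometry_apply, coe_modelIsometry_apply, pow_add]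
  rfl

/-- Neumann series for `(I - z P^*)⁻¹`, convergent since `‖z P^*‖ < 1`. -/
lemma eval_modelIsometry (h : H) {z : ℂ} (hz : ‖z‖ < 1) :
    ((modelIsometry hP h).eval z : H)
      = defectOp P.adjoint (Ring.inverse (1 - z • P.adjoint) h) := by
  have hlt : ‖z • P.adjoint‖ < 1 := by
    rw [norm_smul]
    nlinarith [norm_nonneg z, norm_nonneg P.adjoint, norm_adjoint_le_one hP.1]
  have h1 : HasSum (fun k : ℕ => ((z • P.adjoint) ^ k) h) (Ring.inverse (1 - z • P.adjoint) h) := by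
    have h2 := hasSum_geom_series_inverse _ hlt
    exact h2.mapL (ContinuousLinearMap.apply ℂ H h)
  have h3 := ((modelIsometry hP h).summable hz).hasSum.mapL (DefectSpace P.adjoint).subtypeL
  refine h3.unique ?_
  convert h1.mapL (defectOp P.adjoint) using 2 with k
  simp [coe_modelIsometry_apply, smul_pow]

/-! ### The range of the model isometry is the model space -/

/-- `M_{Θ_P} (z^j ⊗ ξ)`, written through the model isometry. -/
def charMonomial (j : ℕ) (ξ : DefectSpace P) : Hardy (DefectSpace P.adjoint) :=
  (Mz (DefectSpace P.adjoint) ^ (j + 1)) (modelIsometry hP (defectOp P ξ))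
    - lp.single 2 j ⟨P ξ, map_mem_defectSpace P ξ.2⟩

lemma eval_charMonomial (j : ℕ) (ξ : DefectSpace P) {z : ℂ} (hz : ‖z‖ < 1) :
    (charMonomial hP j ξ).eval z
      = charFun P z (Hardy.eval (lp.single 2 j ξ : Hardy (DefectSpace P)) z) := by
  rw [charMonomial, Hardy.eval_sub _ _ hz, Hardy.eval_Mz_pow _ _ hz, Hardy.eval_single,
    Hardy.eval_single, map_smul]
  apply Subtype.ext
  simp [eval_modelIsometry hP _ hz, charFun, pow_succ, mul_smul, smul_add]
  abel

lemma inner_charMonomial (j : ℕ) (ξ : DefectSpace P) (g : Hardy (DefectSpace P.adjoint)) :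
    ⟪charMonomial hP j ξ, g⟫_ℂ
      = ⟪modelIsometry hP (defectOp P ξ), ((Mz (DefectSpace P.adjoint)).adjoint ^ (j + 1)) g⟫_ℂ
        - ⟪P ξ, (g j : H)⟫_ℂ :=
  inner_Mz_pow_sub_single j _ g _

/-- Both terms equal `⟪ξ, D_P P^{*(j+1)} h⟫`: the first because `W` is isometric and turns `M_z^*`
into `P^*`, the second by `P^* D_{P^*} = D_P P^*`. -/
lemma inner_charMonomial_modelIsometry (j : ℕ) (ξ : DefectSpace P) (h : H) :
    ⟪charMonomial hP j ξ, modelIsometry hP h⟫_ℂ = 0 := by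
  rw [inner_charMonomial, adjoint_Mz_pow_modelIsometry, LinearIsometry.inner_map_map,
    coe_modelIsometry_apply, ← ContinuousLinearMap.adjoint_inner_right P,
    adjoint_defectOp_adjoint hP.1, inner_defectOp_left, pow_succ' P.adjoint]
  exact sub_self _

lemma modelIsometry_mem_modelSpace (h : H) : modelIsometry hP h ∈ modelSpace P := by
  rintro g ⟨f, hfg⟩
  have hfN : Filter.Tendsto (fun N => ∑ j ∈ Finset.range N, lp.single 2 j (f j)) Filter.atTop
      (𝓝 f) := (lp.hasSum_single (by norm_num) f).tendsto_sum_nat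
  -- The difference on the left is `M_{Θ_P}` applied to the tail of `f`, so the contraction bound
  -- applies; hence the monomial images sum to `g`.
  have key : ∀ N, ‖g - ∑ j ∈ Finset.range N, charMonomial hP j (f j)‖
      ≤ ‖f - ∑ j ∈ Finset.range N, (lp.single 2 j (f j) : Hardy (DefectSpace P))‖ := by
    intro N
    have hN : ∀ z : ℂ, ‖z‖ < 1 → (g - ∑ j ∈ Finset.range N, charMonomial hP j (f j)).eval z
        = charFun P z
          ((f - ∑ j ∈ Finset.range N, (lp.single 2 j (f j) : Hardy (DefectSpace P))).eval z) := by
      intro z hz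
      induction N with
      | zero => simpa using hfg z hz
      | succ N ih =>
        rw [Finset.sum_range_succ, Finset.sum_range_succ, ← sub_sub, ← sub_sub,
          Hardy.eval_sub _ _ hz, Hardy.eval_sub _ (lp.single 2 N (f N)) hz, ih, map_sub,
          eval_charMonomial hP _ _ hz]
    obtain ⟨g', hg', hle⟩ := exists_charFun_mul hP.1
      (f - ∑ j ∈ Finset.range N, (lp.single 2 j (f j) : Hardy (DefectSpace P)))
    -- The product function furnished by the contraction theorem has the same values on the disc as
    -- this difference, hence is equal to it.
    rwa [Hardy.eval_injective fun z hz => (hg' z hz).trans (hN z hz).symm] at hle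
  have hgN : Filter.Tendsto (fun N => ∑ j ∈ Finset.range N, charMonomial hP j (f j)) Filter.atTop
      (𝓝 g) := by
    rw [tendsto_iff_norm_sub_tendsto_zero] at hfN ⊢
    refine squeeze_zero (fun _ => norm_nonneg _) (fun N => ?_) hfN
    rw [norm_sub_rev, norm_sub_rev _ f]
    exact key N
  refine tendsto_nhds_unique (hgN.inner tendsto_const_nhds) ?_
  simp [sum_inner, inner_charMonomial_modelIsometry]

/-- The model space is contained in the range of the model isometry. -/
lemma exists_modelIsometry_eq {g : Hardy (DefectSpace P.adjoint)} (hg : g ∈ modelSpace P) :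
    ∃ h : H, modelIsometry hP h = g := by
  -- If `g = W h`, then `y j = W^* M_z^{*j} g = P^{*j} h`; so `y 0` is the only candidate preimage.
  let y : ℕ → H := fun j => (modelIsometry hP).toContinuousLinearMap.adjoint
    (((Mz (DefectSpace P.adjoint)).adjoint ^ j) g)
  have hy : ∀ (v : H) (j : ℕ),
      ⟪v, y j⟫_ℂ = ⟪modelIsometry hP v, ((Mz (DefectSpace P.adjoint)).adjoint ^ j) g⟫_ℂ :=
    fun v j => inner_adjoint_isometry _ v _
  clear_value y
  -- Valid for every `g`: the adjoint form of `W v = D_{P^*} v + z W(P^* v)`.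
  have hrec : ∀ j, y j = defectOp P.adjoint (g j) + P (y (j + 1)) := by
    intro j
    refine ext_inner_left ℂ fun v => ?_
    have h1 : ⟪modelIsometry hP v, ((Mz (DefectSpace P.adjoint)).adjoint ^ j) g⟫_ℂ
        = ⟪defectOp P.adjoint v, (g j : H)⟫_ℂ
          + ⟪modelIsometry hP (P.adjoint v),
              ((Mz (DefectSpace P.adjoint)).adjoint ^ (j + 1)) g⟫_ℂ := by
      refine (Hardy.inner_eq_add_of_shift (fun k => rfl) fun k => ?_).trans
        (congrArg (· + _) ?_)
      · rw [adjoint_Mz_pow_apply, adjoint_Mz_pow_apply, show k + 1 + j = k + (j + 1) by omega]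
      · rw [adjoint_Mz_pow_apply, zero_add]
        rfl
    rw [inner_add_right, ← ContinuousLinearMap.adjoint_inner_left P, ← inner_defectOp_left]
    exact (hy v j).trans (h1.trans (congrArg (_ + ·) (hy _ _).symm))
  -- Here membership in the model space enters: `g` is orthogonal to `M_{Θ_P}(z^j D_P v)` for all
  -- `v`, and both sides lie in `𝒟_P`, where the vectors `D_P v` are dense.
  have horth : ∀ j, P.adjoint (g j) = defectOp P (y (j + 1)) := by
    intro j
    have hmem : P.adjoint (g j : H) ∈ DefectSpace P := by
      have := map_mem_defectSpace P.adjoint (g j).2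
      simpa using this
    refine eq_of_inner_defectOp hmem (defectOp_mem _ _) fun v => ?_
    have h1 := hg _ ⟨_, fun z hz => eval_charMonomial hP j ⟨defectOp P v, defectOp_mem P v⟩ hz⟩
    rw [inner_charMonomial, sub_eq_zero, ← hy] at h1
    rw [ContinuousLinearMap.adjoint_inner_right, ← inner_defectOp_left]
    exact h1.symm
  -- Applying `P^*` to the recursion gives `D_P² y_{j+1} + P^* P y_{j+1} = y_{j+1}`.
  have hstep : ∀ j, P.adjoint (y j) = y (j + 1) := by
    intro j
    rw [hrec j, map_add, adjoint_defectOp_adjoint hP.1, horth, defectOp_defectOp hP.1]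
    abel
  -- Applying `D_{P^*}` gives `g_j - P P^* g_j + P D_P y_{j+1}`, whose last two terms cancel.
  have hdef : ∀ j, defectOp P.adjoint (y j) = g j := by
    intro j
    rw [hrec j, map_add, defectOp_adjoint_defectOp_adjoint hP.1, ← map_defectOp hP.1, ← horth]
    abel
  have hpow : ∀ j, (P.adjoint ^ j) (y 0) = y j := by
    intro j
    induction j with
    | zero => simp
    | succ j ih => rw [pow_succ', mul_apply_eq_comp, ih, hstep]
  refine ⟨y 0, ?_⟩
  refine Hardy.ext fun j => Subtype.ext ?_
  rw [coe_modelIsometry_apply, hpow, hdef]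

/-- The unitary of `H` onto the model space of a pure contraction. -/
def modelEquiv : H ≃ₗᵢ[ℂ] modelSpace P :=
  LinearIsometryEquiv.ofSurjective
    { toLinearMap := (modelIsometry hP).toLinearMap.codRestrict (modelSpace P)
        (modelIsometry_mem_modelSpace hP)
      norm_map' := (modelIsometry hP).norm_map }
    fun g => by
      obtain ⟨h, hh⟩ := exists_modelIsometry_eq hP g.2
      exact ⟨h, Subtype.ext hh⟩

end ModelIsometry

/-! ### Fundamental operators and the defect operator -/

section Fundamental

variable {H : Type*} [NormedAddCommGroup H] [InnerProductSpace ℂ H] [CompleteSpace H]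

/-- The relation `D_{P^*} S_i^* = F_{i*} D_{P^*} + F_{(n-i)*}^* D_{P^*} P^*`. -/
lemma IsFundamentalTuple.defectOp_adjoint {m : ℕ} {S : Fin m → (H →L[ℂ] H)} {P : H →L[ℂ] H}
    {F : Fin m → (DefectSpace P.adjoint →L[ℂ] DefectSpace P.adjoint)}
    (hF : IsFundamentalTuple (fun i => (S i).adjoint) P.adjoint F) (hP : ‖P‖ ≤ 1)
    (hS : ∀ i, Commute (S i) P) (i : Fin m) (h : H) :
    defectOp P.adjoint ((S i).adjoint h)
      = F i ⟨defectOp P.adjoint h, defectOp_mem _ _⟩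
        + (F i.rev).adjoint ⟨defectOp P.adjoint (P.adjoint h), defectOp_mem _ _⟩ := by
  have hcomm : ∀ x, (S i).adjoint (P.adjoint x) = P.adjoint ((S i).adjoint x) := fun x =>
    congrArg (fun T : H →L[ℂ] H => T x) (hS i).star_star.eq
  refine eq_of_inner_defectOp (defectOp_mem _ _)
    (Submodule.add_mem _ (Subtype.coe_prop _) (Subtype.coe_prop _)) fun v => ?_
  have h1 := hF i h
  have h2 := hF i.rev v
  simp only [Fin.rev_rev, ContinuousLinearMap.adjoint_adjoint] at h1 h2
  -- Tested against `D_{P^*} v`, the `F_{(n-i)*}^*` term becomes `⟪v, S_{n-i} P^* h⟫ - ⟪v, P P^*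
  -- S_i^* h⟫`, using that `S_i^*` commutes with `P^*`. The first part cancels against the `F_{i*}`
  -- term, leaving `⟪v, (I - P P^*) S_i^* h⟫`.
  have h3 : ⟪defectOp P.adjoint v,
      ((F i.rev).adjoint ⟨defectOp P.adjoint (P.adjoint h), defectOp_mem _ _⟩ : H)⟫_ℂ
      = ⟪(S i.rev).adjoint v - S i (P.adjoint v), P.adjoint h⟫_ℂ := by
    rw [h2, inner_defectOp_left P.adjoint (F i.rev _ : H)]
    exact ContinuousLinearMap.adjoint_inner_right (F i.rev)
      ⟨defectOp P.adjoint v, defectOp_mem _ _⟩ ⟨defectOp P.adjoint (P.adjoint h), defectOp_mem _ _⟩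
  rw [inner_add_right, h3, inner_defectOp_left, inner_defectOp_left, ← h1,
    defectOp_adjoint_defectOp_adjoint hP]
  rw [inner_sub_right, inner_sub_right, inner_sub_left,
    ContinuousLinearMap.adjoint_inner_left (S i.rev),
    ← ContinuousLinearMap.adjoint_inner_right (S i) (P.adjoint v), hcomm,
    ContinuousLinearMap.adjoint_inner_left P]
  ring

end Fundamental

end SymPolydisc

end

/-! ### The functional model -/

set_option maxHeartbeats 2000000 in
theorem theorem4p3 {H : Type*} [NormedAddCommGroup H] [InnerProductSpace ℂ H] [CompleteSpace H]
    (m : ℕ) (hm : 1 ≤ m)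
    (S : Fin m → (H →L[ℂ] H)) (P : H →L[ℂ] H)
    (hSP : SymPolydisc.IsGamContraction (Fin.snoc S P : Fin (m + 1) → (H →L[ℂ] H)))
    (hpure : SymPolydisc.IsPureContraction P)
    (F : Fin m → (SymPolydisc.DefectSpace P.adjoint →L[ℂ] SymPolydisc.DefectSpace P.adjoint))
    (hF : SymPolydisc.IsFundamentalTuple (fun i => (S i).adjoint) P.adjoint F)
    (hFz : ∀ z : ℂ, ‖z‖ ≤ 1 → SymPolydisc.IsGamContraction fun i : Fin m =>
      (((m : ℂ) - (i : ℕ)) / ((m : ℂ) + 1)) • ((F i).adjoint + z • F i.rev)) :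
    ∃ U : H ≃ₗᵢ[ℂ] SymPolydisc.modelSpace P,
      (∀ (i : Fin m) (h : H),
        U (S i h) = SymPolydisc.compression (SymPolydisc.modelSpace P)
          (SymPolydisc.idTensor (F i).adjoint +
            SymPolydisc.Mz (SymPolydisc.DefectSpace P.adjoint) ∘L
              SymPolydisc.idTensor (F i.rev)) (U h)) ∧
      ∀ h : H, U (P h) = SymPolydisc.compression (SymPolydisc.modelSpace P)
        (SymPolydisc.Mz (SymPolydisc.DefectSpace P.adjoint)) (U h) := by
  have hcomm : ∀ i, Commute (S i) P := fun i => by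
    simpa using hSP.commute i.castSucc (Fin.last m)
  refine ⟨SymPolydisc.modelEquiv hpure, fun i => ?_, ?_⟩
  rotate_left
  -- The `k`-th coefficient of `W P^* h` is `D_{P^*} P^{*k} P^* h`, by definition the `(k+1)`-st of
  -- `W h`.
  · exact SymPolydisc.map_eq_compression_Mz (E := SymPolydisc.DefectSpace P.adjoint)
      (K := SymPolydisc.modelSpace P) (A := P) (SymPolydisc.modelEquiv hpure) fun h k => rfl
  refine SymPolydisc.map_eq_compression_idTensor_add_Mz (E := SymPolydisc.DefectSpace P.adjoint)
    (K := SymPolydisc.modelSpace P) (A := S i) (SymPolydisc.modelEquiv hpure) (F i) (F i.rev)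
    fun h k => Subtype.ext ?_
  have hpow : (P.adjoint ^ k) ((S i).adjoint h) = (S i).adjoint ((P.adjoint ^ k) h) :=
    congrArg (fun T : H →L[ℂ] H => T h) ((hcomm i).symm.star_star.pow_left k).eq
  have hs : SymPolydisc.modelSeq P h (k + 1)
      = ⟨SymPolydisc.defectOp P.adjoint (P.adjoint ((P.adjoint ^ k) h)),
        SymPolydisc.defectOp_mem _ _⟩ :=
    Subtype.ext <| congrArg (fun T : H →L[ℂ] H => SymPolydisc.defectOp P.adjoint (T h))
      (pow_succ' P.adjoint k)
  -- Since `S_i^*` commutes with `P^{*k}`, this is the defect relation at the vector `P^{*k} h`.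
  change SymPolydisc.defectOp P.adjoint ((P.adjoint ^ k) ((S i).adjoint h))
    = (F i (SymPolydisc.modelSeq P h k) : H)
      + (F i.rev).adjoint (SymPolydisc.modelSeq P h (k + 1))
  rw [hpow, hF.defectOp_adjoint hpure.1 hcomm, hs]
  rfl
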